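/- For a metric space $N$ let $\mathscr B(N)$ be the family of its bounded subsets. For an ultrafilter $\mathcal U$ on a set $I$ let $(N)_{\mathcal U}$ be the metric ultrapower of $N$: the set of bounded families $(a_i)_{i\in I}$ in $N$, where $(a_i)$ and $(b_i)$ are identified if $\{i: d(a_i,b_i)<\varepsilon\}\in\mathcal U$ for every $\varepsilon>0$, with the metric $\lim_{\mathcal U}d(a_i,b_i)$; for $B\subset N$ let $(B)_{\mathcal U}\subset (N)_{\mathcal U}$ be the set of classes of bounded families of points of $B$. The ultrafilter $\mathcal U$ is free if $\bigcap\{F: F\in\mathcal U\}=\emptyset$. A regular measure of noncompactness is a rule $\mu$ that assigns to every metric space $N$ a function $\mu=\mu_N:\mathscr B(N)\to[0,\infty)$ such that, for all $A,B\in\mathscr B(N)$: (1) if $N$ is complete, then $\mu(B)=0$ if and only if $B$ is relatively compact; (2) $B\subset A$ implies $\mu(B)\le\mu(A)$; (3) $\mu(A\cup B)=\max\{\mu(A),\mu(B)\}$; and, whenever $N$ is a real Banach space, (4) $\mu(\operatorname{co}(B))=\mu(B)$; (5) $\mu(kB)=|k|\,\mu(B)$ for every scalar $k$; (6) $\mu(A+B)\le\mu(A)+\mu(B)$.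 For a metric space $M$, such a $\mu$ is called an ultra-isometric-invariant on $M$ if for every $B\in\mathscr B(M)$ $$\mu_N(T(B))=\mu_M(B)=\mu_{(M)_{\mathcal U}}\big((B)_{\mathcal U}\big)$$ for every metric space $N$, every (not necessarily surjective) isometry $T:M\to N$, and every free ultrafilter $\mathcal U$ on any index set. Theorem 5.5. Let $M$ be a metric space and let $\mu$ be a regular measure of noncompactness that is an ultra-isometric-invariant on $M$. Then every $B\in\mathscr B(M)$ has a countable subset $B_0\subset B$ with $\mu_M(B_0)=\mu_M(B)$. -/

import Mathlib

open Filter Topology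
open scoped NNReal Pointwise

universe u

/-- The bounded families `(a i)` of points of `M` indexed by `I`. The ultrafilter is carried along
so that the families can be given the pseudometric that it induces. -/
structure BoundedFamily {I : Type u} (U : Ultrafilter I) (M : Type u) [MetricSpace M] where
  /-- The underlying family. -/
  toFun : I → M
  bounded : Bornology.IsBounded (Set.range toFun)

namespace BoundedFamily

variable {I : Type u} {U : Ultrafilter I} {M : Type u} [MetricSpace M]

/-- The distance of two bounded families: the limit of `dist (a i) (b i)` along `U`. -/
noncomputable instance : Dist (BoundedFamily U M) where
  dist a b := limUnder (U : Filter I) fun i => dist (a.toFun i) (b.toFun i)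

/-- The limit in the definition of the distance exists. -/
theorem tendsto_dist (a b : BoundedFamily U M) :
    Tendsto (fun i => dist (a.toFun i) (b.toFun i)) U (𝓝 (dist a b)) := by
  obtain ⟨C, hC⟩ := Metric.isBounded_iff.1 (a.bounded.union b.bounded)
  have hmem : ∀ i, dist (a.toFun i) (b.toFun i) ∈ Set.Icc (0 : ℝ) C := fun i =>
    ⟨dist_nonneg, hC (Or.inl ⟨i, rfl⟩) (Or.inr ⟨i, rfl⟩)⟩
  obtain ⟨x, -, hx⟩ := isCompact_Icc.ultrafilter_le_nhds
    (U.map fun i => dist (a.toFun i) (b.toFun i))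
    (le_principal_iff.2 (Filter.mem_map.2 (Filter.univ_mem' hmem)))
  exact tendsto_nhds_limUnder ⟨x, hx⟩

noncomputable instance : PseudoMetricSpace (BoundedFamily U M) where
  dist_self a := tendsto_nhds_unique (tendsto_dist a a) (by simp)
  dist_comm a b := tendsto_nhds_unique (tendsto_dist a b) (by
    simpa only [dist_comm] using tendsto_dist b a)
  dist_triangle a b c := le_of_tendsto_of_tendsto' (tendsto_dist a c)
    ((tendsto_dist a b).add (tendsto_dist b c)) fun _ => dist_triangle _ _ _

/-- Two families are at distance `0`, and so become equal in the ultrapower, exactly when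
`{i | dist (a i) (b i) < ε}` belongs to `U` for every `ε > 0`. -/
theorem dist_eq_zero_iff (a b : BoundedFamily U M) :
    dist a b = 0 ↔ ∀ ε > 0, {i | dist (a.toFun i) (b.toFun i) < ε} ∈ U := by
  constructor
  · intro h ε hε
    have ht := tendsto_dist a b
    rw [h] at ht
    exact ht (Iio_mem_nhds hε)
  · intro h
    refine tendsto_nhds_unique (tendsto_dist a b) (Metric.tendsto_nhds.2 fun ε hε => ?_)
    filter_upwards [h ε hε] with i hi
    simpa [abs_of_nonneg dist_nonneg] using hi

end BoundedFamily

/-- The ultrapower `(M)_U` of a metric space `M`: bounded families modulo distance `0`, with the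
metric `lim_U dist (a i) (b i)`. -/
abbrev Ultrapower {I : Type u} (U : Ultrafilter I) (M : Type u) [MetricSpace M] : Type u :=
  SeparationQuotient (BoundedFamily U M)

/-- The ultrapower `(B)_U` of a subset `B` of `M`, as a subset of `(M)_U`: the classes of the
bounded families of points of `B`. -/
def ultrapowerSet {I : Type u} (U : Ultrafilter I) {M : Type u} [MetricSpace M] (B : Set M) :
    Set (Ultrapower U M) :=
  SeparationQuotient.mk '' {a : BoundedFamily U M | ∀ i, a.toFun i ∈ B}

/-- `ν` is a measure of noncompactness on the metric space `N`. Only the values of `ν` on bounded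
sets matter. Relative compactness is demanded in complete spaces only. -/
structure IsMeasureOfNoncompactness {N : Type u} [MetricSpace N] (ν : Set N → ℝ≥0) : Prop where
  eq_zero_iff : CompleteSpace N → ∀ B : Set N, Bornology.IsBounded B →
    (ν B = 0 ↔ IsCompact (closure B))
  mono : ∀ A B : Set N, Bornology.IsBounded A → Bornology.IsBounded B → B ⊆ A → ν B ≤ ν A
  union : ∀ A B : Set N, Bornology.IsBounded A → Bornology.IsBounded B →
    ν (A ∪ B) = max (ν A) (ν B)

/-- `ν` is a regular measure of noncompactness on the normed space `X`. -/
structure IsRegularMeasureOfNoncompactness {X : Type u} [NormedAddCommGroup X] [NormedSpace ℝ X]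
    (ν : Set X → ℝ≥0) : Prop extends IsMeasureOfNoncompactness ν where
  convexHull_eq : ∀ B : Set X, Bornology.IsBounded B → ν (convexHull ℝ B) = ν B
  smul_eq : ∀ (k : ℝ) (B : Set X), Bornology.IsBounded B → ν (k • B) = ‖k‖₊ * ν B
  add_le : ∀ A B : Set X, Bornology.IsBounded A → Bornology.IsBounded B → ν (A + B) ≤ ν A + ν B

/-- A rule `μ` that assigns to every metric space a set function on it (as the Kuratowski measure
does) is a regular measure of noncompactness if it is a measure of noncompactness on every metric
space and a regular one on every Banach space. -/
structure IsRegularRule (μ : ∀ (N : Type u) [MetricSpace N], Set N → ℝ≥0) : Prop where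
  metric : ∀ (N : Type u) [MetricSpace N], IsMeasureOfNoncompactness (μ N)
  banach : ∀ (X : Type u) [NormedAddCommGroup X] [NormedSpace ℝ X] [CompleteSpace X],
    IsRegularMeasureOfNoncompactness (μ X)

/-- `μ` is an ultra-isometric-invariant on `M`: its values on the bounded subsets `B` of `M` do not
change under (not necessarily surjective) isometries of `M` into metric spaces, nor under passing
to the ultrapower along a free ultrafilter. -/
structure IsUltraIsometricInvariant (μ : ∀ (N : Type u) [MetricSpace N], Set N → ℝ≥0)
    (M : Type u) [MetricSpace M] : Prop where
  isometry : ∀ (N : Type u) [MetricSpace N] (T : M → N), Isometry T →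
    ∀ B : Set M, Bornology.IsBounded B → μ N (T '' B) = μ M B
  ultrapower : ∀ (I : Type u) (U : Ultrafilter I), ⋂₀ (U : Filter I).sets = ∅ →
    ∀ B : Set M, Bornology.IsBounded B → μ (Ultrapower U M) (ultrapowerSet U B) = μ M B

/-! Distance matrices of finite tuples live in separable spaces, so countably many tuples
approximate all of them. Collecting their entries that are required to lie in `B` gives `B₀`. Finite
pieces of `M` then map almost isometrically into `M`, points of `B` going into `B₀`. Gluing these
maps along an ultrafilter gives an isometry `T` of `M` with `T(B) ⊆ (B₀)_U`, whence `μ(B) = μ(T(B))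
≤ μ((B₀)_U) = μ(B₀) ≤ μ(B)`. -/

/-- A map into a second countable space is approximated pointwise by its values on a countable
subset of the domain. -/
theorem exists_countable_dist_lt {X Y : Type*} [PseudoMetricSpace Y] [SecondCountableTopology Y]
    (g : X → Y) :
    ∃ C : Set X, C.Countable ∧ ∀ x, ∀ ε > 0, ∃ c ∈ C, dist (g c) (g x) < ε := by
  -- Density for the pulled-back pseudometric is exactly the required approximation.
  let _ : PseudoMetricSpace X := PseudoMetricSpace.induced g inferInstance
  have : SecondCountableTopology X := TopologicalSpace.secondCountableTopology_induced X Y g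
  obtain ⟨C, hC, hd⟩ := TopologicalSpace.exists_countable_dense X
  refine ⟨C, hC, fun x ε hε => ?_⟩
  obtain ⟨c, hc, h⟩ := hd.exists_dist_lt x hε
  exact ⟨c, hc, by rw [dist_comm]; exact h⟩

/-- Every subset `B` of a metric space `M` has a countable subset `B₀` such that each finite subset
of `M` admits almost isometric maps into `M` that send its points in `B` to points of `B₀`. -/
theorem exists_countable_almost_isometric {M : Type*} [MetricSpace M] (B : Set M) :
    ∃ B₀ ⊆ B, B₀.Countable ∧ ∀ (F : Finset M), ∀ ε > 0, ∃ φ : M → M,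
      (∀ x ∈ F, x ∈ B → φ x ∈ B₀) ∧
        ∀ x ∈ F, ∀ y ∈ F, |dist (φ x) (φ y) - dist x y| < ε := by
  classical
  -- `p.2` marks the coordinates confined to `B`. The others range over `M`, since `T` must be
  -- defined on all of `M`.
  have key : ∀ p : Σ n : ℕ, Finset (Fin n),
      ∃ C : Set {f : Fin p.1 → M // ∀ i ∈ p.2, f i ∈ B}, C.Countable ∧
        ∀ f : {f : Fin p.1 → M // ∀ i ∈ p.2, f i ∈ B}, ∀ ε > 0, ∃ c ∈ C,
          dist (fun i j => dist (c.1 i) (c.1 j)) (fun i j => dist (f.1 i) (f.1 j)) < ε :=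
    fun p => exists_countable_dist_lt
      fun f : {f : Fin p.1 → M // ∀ i ∈ p.2, f i ∈ B} => fun i j => dist (f.1 i) (f.1 j)
  choose C hC hdense using key
  refine ⟨⋃ p, ⋃ c ∈ C p, c.1 '' p.2, ?_, ?_, ?_⟩
  · simp only [Set.iUnion_subset_iff, Set.image_subset_iff]
    exact fun p c _ i hi => c.2 i hi
  · exact Set.countable_iUnion fun p => (hC p).biUnion fun c _ => (Set.toFinite _).countable
  · intro F ε hε
    let e := F.equivFin
    let S : Finset (Fin F.card) := {i | (e.symm i : M) ∈ B}
    obtain ⟨c, hc, h⟩ := hdense ⟨F.card, S⟩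
      ⟨fun i => (e.symm i : M), fun i hi => (Finset.mem_filter.1 hi).2⟩ ε hε
    refine ⟨fun x => if hx : x ∈ F then c.1 (e ⟨x, hx⟩) else x, fun x hx hxB => ?_,
      fun x hx y hy => ?_⟩
    · simp only [dif_pos hx, Set.mem_iUnion]
      exact ⟨_, c, hc, Set.mem_image_of_mem _ (by simpa [S] using hxB)⟩
    · have h1 := (dist_le_pi_dist _ _ (e ⟨x, hx⟩)).trans_lt h
      have h2 := (dist_le_pi_dist _ _ (e ⟨y, hy⟩)).trans_lt h1
      simpa only [dif_pos hx, dif_pos hy, Equiv.symm_apply_apply, Real.dist_eq] using h2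

/-- Every bounded subset `B` of `M` has a countable subset `B₀` such that some isometry of `M` into
its ultrapower along a free ultrafilter maps `B` into the ultrapower of `B₀`. -/
theorem exists_countable_isometry_ultrapower {M : Type u} [MetricSpace M] {B : Set M}
    (hB : Bornology.IsBounded B) (hne : B.Nonempty) :
    ∃ B₀ ⊆ B, B₀.Countable ∧ ∃ (I : Type u) (U : Ultrafilter I), ⋂₀ (U : Filter I).sets = ∅ ∧
      ∃ T : M → Ultrapower U M, Isometry T ∧ T '' B ⊆ ultrapowerSet U B₀ := by
  classical
  obtain ⟨B₀, hsub, hcount, happrox⟩ := exists_countable_almost_isometric B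
  obtain ⟨b, hb⟩ : B₀.Nonempty := by
    obtain ⟨x, hx⟩ := hne
    obtain ⟨φ, hφ, -⟩ := happrox {x} 1 one_pos
    exact ⟨φ x, hφ x (Finset.mem_singleton_self x) hx⟩
  obtain ⟨R, hR⟩ := hB.subset_closedBall b
  have hε : ∀ n : ℕ, (0 : ℝ) < 1 / (n + 1) := fun n => Nat.one_div_pos_of_nat
  -- The base point `b` joins every finite set: `φ i b` lies in `B₀`, hence within `R` of `b`, which
  -- will bound the families `a x`.
  choose φ hφB hφ using fun i : Finset M × ℕ => happrox (insert b i.1) (1 / (i.2 + 1)) (hε i.2)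
  let U : Ultrafilter (Finset M × ℕ) := Ultrafilter.of atTop
  have hU : (U : Filter (Finset M × ℕ)) ≤ atTop := Ultrafilter.of_le atTop
  -- The default `b` lies in `B₀`, so for `x ∈ B` every term of `a x` does, not just `U`-almost
  -- every one.
  let a : M → Finset M × ℕ → M := fun x i => if x ∈ i.1 then φ i x else b
  have ha : ∀ x, Bornology.IsBounded (Set.range (a x)) := by
    refine fun x => (Metric.isBounded_closedBall (x := b) (r := dist x b + 1 + R)).subset ?_
    rintro _ ⟨i, rfl⟩
    have hφb : dist (φ i b) b ≤ R :=
      hR (hsub (hφB i b (Finset.mem_insert_self _ _) (hsub hb)))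
    have hR0 : 0 ≤ R := dist_nonneg.trans hφb
    rw [Metric.mem_closedBall]
    by_cases hx : x ∈ i.1
    · have h1 := (abs_lt.1 (hφ i x (Finset.mem_insert_of_mem hx) b
        (Finset.mem_insert_self _ _))).2
      have h2 : (1 : ℝ) / (i.2 + 1) ≤ 1 := by
        rw [div_le_one (by positivity)]
        linarith [(Nat.cast_nonneg i.2 : (0 : ℝ) ≤ i.2)]
      simp only [a, if_pos hx]
      linarith [dist_triangle (φ i x) (φ i b) b]
    · simp only [a, if_neg hx, dist_self]
      positivity
  let T : M → Ultrapower U M := fun x => SeparationQuotient.mk ⟨a x, ha x⟩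
  refine ⟨B₀, hsub, hcount, _, U, ?_, T, Isometry.of_dist_eq fun x y => ?_, ?_⟩
  -- The factor `ℕ` leaves the index set without a maximal element even if `M` is finite, so `U` is
  -- free.
  · refine Set.eq_empty_iff_forall_notMem.2 fun i hi => ?_
    have h : (i.1, i.2 + 1) ≤ i := hi _ (hU (mem_atTop (i.1, i.2 + 1)))
    exact absurd h.2 (by simp)
  · rw [SeparationQuotient.dist_mk]
    refine tendsto_nhds_unique (BoundedFamily.tendsto_dist _ _) ?_
    have hlim : Tendsto (fun i : Finset M × ℕ => (1 : ℝ) / (i.2 + 1)) U (𝓝 0) :=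
      (tendsto_one_div_add_atTop_nhds_zero_nat.comp
        (tendsto_snd.mono_left prod_atTop_atTop_eq.ge)).mono_left hU
    refine tendsto_iff_dist_tendsto_zero.2
      (squeeze_zero' (Eventually.of_forall fun _ => dist_nonneg) ?_ hlim)
    filter_upwards [hU (mem_atTop (({x, y} : Finset M), 0))] with i hi
    have hx : x ∈ i.1 := hi.1 (by simp)
    have hy : y ∈ i.1 := hi.1 (by simp)
    simp only [a, if_pos hx, if_pos hy, Real.dist_eq]
    exact (hφ i x (Finset.mem_insert_of_mem hx) y (Finset.mem_insert_of_mem hy)).le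
  · rintro _ ⟨x, hx, rfl⟩
    refine ⟨⟨a x, ha x⟩, fun i => ?_, rfl⟩
    by_cases hxi : x ∈ i.1
    · simpa only [a, if_pos hxi] using hφB i x (Finset.mem_insert_of_mem hxi) hx
    · simpa only [a, if_neg hxi] using hb

/-- The ultrapower of a bounded set is bounded. -/
theorem isBounded_ultrapowerSet {I : Type u} (U : Ultrafilter I) {M : Type u} [MetricSpace M]
    {B : Set M} (hB : Bornology.IsBounded B) : Bornology.IsBounded (ultrapowerSet U B) := by
  obtain ⟨C, hC⟩ := Metric.isBounded_iff.1 hB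
  refine Metric.isBounded_iff.2 ⟨C, ?_⟩
  rintro _ ⟨a, ha, rfl⟩ _ ⟨b, hb, rfl⟩
  rw [SeparationQuotient.dist_mk]
  exact le_of_tendsto' (BoundedFamily.tendsto_dist a b) fun i => hC (ha i) (hb i)

theorem theorem5p5 (M : Type u) [MetricSpace M]
    (μ : ∀ (N : Type u) [MetricSpace N], Set N → ℝ≥0)
    (hμ : IsRegularRule μ) (hinv : IsUltraIsometricInvariant μ M)
    (B : Set M) (hB : Bornology.IsBounded B) :
    ∃ B₀ : Set M, B₀ ⊆ B ∧ B₀.Countable ∧ μ M B₀ = μ M B := by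
  rcases B.eq_empty_or_nonempty with rfl | hne
  · exact ⟨∅, subset_rfl, Set.countable_empty, rfl⟩
  obtain ⟨B₀, hsub, hcount, I, U, hfree, T, hT, hTB⟩ :=
    exists_countable_isometry_ultrapower hB hne
  have hB₀ := hB.subset hsub
  refine ⟨B₀, hsub, hcount, ((hμ.metric M).mono B B₀ hB hB₀ hsub).antisymm ?_⟩
  have hbdd := isBounded_ultrapowerSet U hB₀
  rw [← hinv.isometry _ T hT B hB, ← hinv.ultrapower I U hfree B₀ hB₀]
  exact (hμ.metric _).mono _ _ hbdd (hbdd.subset hTB) hTB
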